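/- For a nonnegative integer $N$ let $p(N)$ denote the number of partitions of $N$ (with $p(0)=1$). Define integers $a(n)$ and $b(n)$ by the formal power series identities $$\sum_{n=0}^{\infty} a(n)q^n := \prod_{m=1}^{\infty}(1-q^m)^{11}, \qquad \sum_{n=0}^{\infty} b(n)q^n := \prod_{m=1}^{\infty}(1-q^m)^{23}.$$ If $k$ and $n$ are nonnegative integers, then $\frac{13^{2k+1}(24n+11)+1}{24}$ and $\frac{13^{2k+2}(24n+23)+1}{24}$ are integers, and $$p\left(\frac{13^{2k+1}(24n+11)+1}{24}\right) \equiv 11\cdot 6^k\cdot a(n) \pmod{13},$$ $$p\left(\frac{13^{2k+2}(24n+23)+1}{24}\right) \equiv 10\cdot 6^k\cdot b(n) \pmod{13}.$$ -/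

import Mathlib

open scoped PowerSeries.WithPiTopology

/-- The number `p(n)` of partitions of `n` (so `p(0) = 1`). -/
def partitionCount (n : ℕ) : ℕ := Fintype.card (Nat.Partition n)

/-- The infinite product `∏_{m ≥ 1} (1 - q^m)^r` in `ℤ⟦q⟧`, where `ℤ⟦q⟧` carries the topology of
coefficientwise convergence (`ℤ` being discrete); it converges by `hasProd_eulerPower`. -/
noncomputable def eulerPower (r : ℕ) : PowerSeries ℤ :=
  ∏' m : ℕ, (1 - (PowerSeries.X : PowerSeries ℤ) ^ (m + 1)) ^ r

/-- The infinite product defining `eulerPower r` converges. -/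
theorem hasProd_eulerPower (r : ℕ) :
    HasProd (fun m : ℕ => (1 - (PowerSeries.X : PowerSeries ℤ) ^ (m + 1)) ^ r) (eulerPower r) :=
  ((PowerSeries.WithPiTopology.multipliable_one_sub_X_pow ℤ).pow r).hasProd

/-- `a(n)`, the coefficient of `q^n` in `∏_{m ≥ 1} (1 - q^m)^11`. -/
noncomputable def coeffA (n : ℕ) : ℤ := PowerSeries.coeff n (eulerPower 11)

/-- `b(n)`, the coefficient of `q^n` in `∏_{m ≥ 1} (1 - q^m)^23`. -/
noncomputable def coeffB (n : ℕ) : ℤ := PowerSeries.coeff n (eulerPower 23)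

/-! Let φ = ∏(1-q^m) (the series `pentagonalSeries`), Δ = qφ^24, Q = E₄, R = E₆ and θ = q d/dq. The
heart is that modulo 13 the operator U : ∑ a(n)q^n ↦ ∑ a(13n)q^n sends Δ^j, for 0 < j < 12, to a
multiple of Δ (`exists_coeff_deltaSeries_pow`).

Modulo 13, E₁₂ ≡ 1 and E₁₄ ≡ E₂, so the level-one identities in weights 12 and 14 become Q³ = 1 +
5Δ, R² = 1 + 6Δ and θΔ = Q²RΔ. Hence θ⁶ maps polynomials in Δ to polynomials in Δ, raising the
degree by at most 7 (`exists_theta_six_evalDelta`). By Fermat, Δ^j - θ¹²Δ^j is the part of Δ^j with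
exponents divisible by 13. It is a polynomial in Δ of degree at most 25, without constant term and
killed by θ, so it equals cΔ¹³ = cΔ(q¹³).

Since φ¹³ = φ(q¹³), multiplying a series by φ^(13t) only multiplies its image under U by φ^t.
Applied to q⁷/φ, qφ¹¹ and q⁸φ²³, this gives p(13n+6) = 11a(n), a(13n+12) = 8b(n) and b(13n+5) =
4a(n), each constant being read off at n = 0. Alternating the last two yields the theorem, as 11·8 =
10 and 10·4 = 11·6 modulo 13. -/

/-- The power series `∑ σ_k(n) X^n`. -/
noncomputable def sigmaSeries (R : Type*) [CommRing R] (k : ℕ) : PowerSeries R :=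
  PowerSeries.mk fun n => (ArithmeticFunction.sigma k n : R)

theorem map_sigmaSeries {R S : Type*} [CommRing R] [CommRing S] (φ : R →+* S) (k : ℕ) :
    PowerSeries.map φ (sigmaSeries R k) = sigmaSeries S k := by
  ext n
  simp [sigmaSeries]

/-! ### Eisenstein series identities in weights 12 and 14. -/

section EisensteinSeries

open UpperHalfPlane ModularForm EisensteinSeries
open scoped MatrixGroups

theorem qExpansion_E {k : ℕ} (hk : 3 ≤ k) (hk2 : Even k) :
    qExpansion 1 (E hk) =
      1 + PowerSeries.C (-(2 * k / bernoulli k : ℂ)) * sigmaSeries ℂ (k - 1) := by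
  ext m
  rw [E_qExpansion_coeff hk hk2]
  rcases eq_or_ne m 0 with rfl | hm
  · simp [sigmaSeries, PowerSeries.coeff_zero_eq_constantCoeff]
  · simp [sigmaSeries, hm, PowerSeries.coeff_one, PowerSeries.coeff_C_mul]

theorem qExpansion_E₄ : qExpansion 1 E₄ = 1 + 240 * sigmaSeries ℂ 3 := by
  rw [qExpansion_E _ ⟨2, rfl⟩, show bernoulli 4 = -1 / 30 by decide +kernel]
  norm_num
  exact .inl rfl

theorem qExpansion_E₆ : qExpansion 1 E₆ = 1 - 504 * sigmaSeries ℂ 5 := by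
  rw [qExpansion_E _ ⟨3, rfl⟩, show bernoulli 6 = 1 / 42 by decide +kernel]
  norm_num
  rw [sub_eq_add_neg]
  rfl

theorem qExpansion_E₁₂ :
    691 * qExpansion 1 (E (by norm_num : 3 ≤ 12)) = 691 + 65520 * sigmaSeries ℂ 11 := by
  rw [qExpansion_E _ ⟨6, rfl⟩, show bernoulli 12 = -691 / 2730 by decide +kernel,
    mul_add, mul_one, ← mul_assoc, show (691 : PowerSeries ℂ) = PowerSeries.C 691 from rfl,
    ← map_mul, show (65520 : PowerSeries ℂ) = PowerSeries.C 65520 from rfl]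
  norm_num

theorem qExpansion_E₁₄ :
    qExpansion 1 (E (by norm_num : 3 ≤ 14)) = 1 - 24 * sigmaSeries ℂ 13 := by
  rw [qExpansion_E _ ⟨7, rfl⟩, show bernoulli 14 = 7 / 6 by decide +kernel]
  norm_num
  rw [sub_eq_add_neg]
  rfl

/-- Sturm bound: a nonzero level-one form of weight k vanishes at the cusp to order at most k/12 <
2. -/
theorem ModularForm.eq_zero_of_coeff_zero_of_coeff_one {k : ℕ} (hk : k < 24)
    {f : ModularForm 𝒮ℒ (k : ℤ)} (h0 : (qExpansion 1 f).coeff 0 = 0)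
    (h1 : (qExpansion 1 f).coeff 1 = 0) : f = 0 := by
  apply sturm_bound_levelOne_nat
  refine lt_of_lt_of_le (b := ((2 : ℕ) : ℕ∞)) (by norm_cast; omega) ?_
  apply PowerSeries.nat_le_order
  intro i hi
  interval_cases i <;> assumption

theorem sigmaSeries_fourteen :
    (1 - 24 * sigmaSeries ℂ 13) =
      (1 + 240 * sigmaSeries ℂ 3) ^ 2 * (1 - 504 * sigmaSeries ℂ 5) := by
  let f : ModularForm 𝒮ℒ ((14 : ℕ) : ℤ) :=
    ModularForm.mcast (by decide) (E (by norm_num : 3 ≤ 14)) -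
    ModularForm.mcast (by decide) ((E₄.pow 2).mul E₆)
  have hq : qExpansion 1 f = (1 - 24 * sigmaSeries ℂ 13) -
      (1 + 240 * sigmaSeries ℂ 3) ^ 2 * (1 - 504 * sigmaSeries ℂ 5) := by
    simp only [f, FunLike.coe_sub, coe_mcast,
      ModularForm.qExpansion_sub one_pos one_mem_strictPeriods_SL,
      ModularForm.qExpansion_mul one_pos one_mem_strictPeriods_SL,
      ModularForm.qExpansion_pow one_pos one_mem_strictPeriods_SL,
      qExpansion_E₁₄, qExpansion_E₄, qExpansion_E₆]
  have hf : f = 0 := by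
    apply ModularForm.eq_zero_of_coeff_zero_of_coeff_one (by norm_num) <;> rw [hq]
    · simp [sigmaSeries]
    · have : (504 : PowerSeries ℂ) = PowerSeries.C 504 := rfl
      have h2 : (240 : PowerSeries ℂ) = PowerSeries.C 240 := rfl
      have h3 : (24 : PowerSeries ℂ) = PowerSeries.C 24 := rfl
      rw [this, h2, h3]
      norm_num [sigmaSeries, PowerSeries.coeff_mul, Finset.Nat.antidiagonal_succ, pow_two,
        PowerSeries.coeff_one, PowerSeries.coeff_C_mul]
  rw [hf] at hq
  rw [← sub_eq_zero, ← hq]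
  exact qExpansion_zero 1

theorem sigmaSeries_twelve :
    691 + 65520 * sigmaSeries ℂ 11 = 441 * (1 + 240 * sigmaSeries ℂ 3) ^ 3 +
      250 * (1 - 504 * sigmaSeries ℂ 5) ^ 2 := by
  let f : ModularForm 𝒮ℒ ((12 : ℕ) : ℤ) :=
    (691 : ℂ) • ModularForm.mcast (by decide) (E (by norm_num : 3 ≤ 12)) -
    ((441 : ℂ) • ModularForm.mcast (by decide) (E₄.pow 3) +
      (250 : ℂ) • ModularForm.mcast (by decide) (E₆.pow 2))
  have hq : qExpansion 1 f = 691 + 65520 * sigmaSeries ℂ 11 -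
      (441 * (1 + 240 * sigmaSeries ℂ 3) ^ 3 + 250 * (1 - 504 * sigmaSeries ℂ 5) ^ 2) := by
    have hs (c : ℂ) (g : ModularForm 𝒮ℒ ((12 : ℕ) : ℤ)) :
        qExpansionAddHom one_pos one_mem_strictPeriods_SL _ (c • g) =
          PowerSeries.C c * qExpansion 1 g := by
      rw [← PowerSeries.smul_eq_C_mul]
      exact ModularForm.qExpansion_smul one_pos one_mem_strictPeriods_SL c g
    change qExpansionAddHom one_pos one_mem_strictPeriods_SL _ f = _
    rw [map_sub, map_add, hs, hs, hs]
    simp only [coe_mcast, ModularForm.qExpansion_pow one_pos one_mem_strictPeriods_SL,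
      ← qExpansion_E₁₂, qExpansion_E₄, qExpansion_E₆]
    rfl
  have hf : f = 0 := by
    apply ModularForm.eq_zero_of_coeff_zero_of_coeff_one (by norm_num) <;> rw [hq]
    · have h3 : (691 : PowerSeries ℂ) = PowerSeries.C 691 := rfl
      have h4 : (441 : PowerSeries ℂ) = PowerSeries.C 441 := rfl
      have h5 : (250 : PowerSeries ℂ) = PowerSeries.C 250 := rfl
      rw [h3, h4, h5]
      norm_num [sigmaSeries]
    · have : (504 : PowerSeries ℂ) = PowerSeries.C 504 := rfl
      have h2 : (240 : PowerSeries ℂ) = PowerSeries.C 240 := rfl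
      have h3 : (691 : PowerSeries ℂ) = PowerSeries.C 691 := rfl
      have h4 : (441 : PowerSeries ℂ) = PowerSeries.C 441 := rfl
      have h5 : (250 : PowerSeries ℂ) = PowerSeries.C 250 := rfl
      have h6 : (65520 : PowerSeries ℂ) = PowerSeries.C 65520 := rfl
      rw [this, h2, h3, h4, h5, h6]
      norm_num [sigmaSeries, PowerSeries.coeff_mul, Finset.Nat.antidiagonal_succ, pow_succ,
        PowerSeries.coeff_one, PowerSeries.coeff_C_mul, PowerSeries.coeff_C]
  rw [hf] at hq
  rw [← sub_eq_zero, ← hq]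
  exact qExpansion_zero 1

end EisensteinSeries

/-! ### Taylor coefficients at 0 of the analytic Euler product. -/

section TaylorSeries

open Filter Topology

/-- The Taylor series at the origin of a function of a complex variable. -/
noncomputable def taylorSeriesZero (g : ℂ → ℂ) : PowerSeries ℂ :=
  .mk fun m => (m.factorial : ℂ)⁻¹ * iteratedDeriv m g 0

theorem taylorSeriesZero_congr {f g : ℂ → ℂ} (h : f =ᶠ[𝓝 0] g) :
    taylorSeriesZero f = taylorSeriesZero g := by
  ext m
  simp [taylorSeriesZero, h.iteratedDeriv_eq m]

theorem taylorSeriesZero_mul {f g : ℂ → ℂ} (hf : AnalyticAt ℂ f 0) (hg : AnalyticAt ℂ g 0) :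
    taylorSeriesZero (f * g) = taylorSeriesZero f * taylorSeriesZero g := by
  ext
  simp only [taylorSeriesZero, PowerSeries.coeff_mk,
    iteratedDeriv_mul hf.contDiffAt hg.contDiffAt, Finset.mul_sum, PowerSeries.coeff_mul,
    Finset.Nat.sum_antidiagonal_eq_sum_range_succ_mk, Nat.succ_eq_add_one]
  refine Finset.sum_congr rfl fun i hi => ?_
  rw [Nat.cast_choose _ (by grind)]
  field_simp [Nat.factorial_ne_zero]

theorem taylorSeriesZero_eval (p : Polynomial ℂ) :
    taylorSeriesZero (fun z => p.eval z) = p := by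
  ext m
  have h : iteratedDeriv m (fun z => p.eval z) =
      fun z => (Polynomial.derivative^[m] p).eval z := by
    induction m with
    | zero => simp
    | succ m ih =>
      rw [iteratedDeriv_succ, ih, Function.iterate_succ_apply']
      ext z
      simp
  rw [taylorSeriesZero, PowerSeries.coeff_mk, h]
  dsimp only
  rw [← Polynomial.coeff_zero_eq_eval_zero,
    Polynomial.coeff_iterate_derivative, Polynomial.coeff_coe]
  simp [Nat.descFactorial_self, Nat.factorial_ne_zero]

theorem taylorSeriesZero_pow {f : ℂ → ℂ} (hf : AnalyticAt ℂ f 0) (n : ℕ) :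
    taylorSeriesZero (f ^ n) = taylorSeriesZero f ^ n := by
  induction n with
  | zero =>
    have := taylorSeriesZero_eval 1
    simpa [Pi.one_def] using this
  | succ n ih => rw [pow_succ, taylorSeriesZero_mul (hf.pow n) hf, ih, pow_succ]

theorem tendsto_coeff_taylorSeriesZero {ι : Type*} {l : Filter ι} {F : ι → ℂ → ℂ} {f : ℂ → ℂ}
    {U : Set ℂ} (hU : IsOpen U) (h0 : 0 ∈ U) (hF : ∀ i, ContDiff ℂ ⊤ (F i))
    (h : TendstoLocallyUniformlyOn F f l U) (m : ℕ) :
    Tendsto (fun i => (taylorSeriesZero (F i)).coeff m) l (𝓝 ((taylorSeriesZero f).coeff m)) := by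
  have key : TendstoLocallyUniformlyOn (fun i => iteratedDeriv m (F i))
      (iteratedDeriv m f) l U := by
    induction m with
    | zero => simpa using h
    | succ m ih =>
      simp only [iteratedDeriv_succ]
      refine ih.deriv (Eventually.of_forall fun i => ?_) hU
      exact ((hF i).differentiable_iteratedDeriv m (WithTop.coe_lt_top _)).differentiableOn
  simpa [taylorSeriesZero] using (key.tendsto_at h0).const_mul _

/-- The finite products converge locally uniformly on the unit disc, so their Taylor coefficients
converge; each coefficient is also eventually equal to that of the formal product. -/
theorem taylorSeriesZero_tprod_one_sub_pow :
    taylorSeriesZero (fun q => ∏' n : ℕ, (1 - q ^ (n + 1))) = PowerSeries.pentagonalSeries ℂ := by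
  ext m
  have h := ModularForm.multipliableLocallyUniformlyOn_one_sub_pow.hasProdLocallyUniformlyOn
  refine tendsto_nhds_unique (tendsto_coeff_taylorSeriesZero Metric.isOpen_ball
    (Metric.mem_ball_self one_pos) (fun s => ?_) h m) ?_
  · fun_prop
  · refine tendsto_nhds_of_eventually_eq ?_
    filter_upwards [PowerSeries.coeff_prod_one_sub_X_pow_eventually_eq ℂ m] with s hs
    rw [← hs]
    have := taylorSeriesZero_eval (∏ n ∈ s, (1 - Polynomial.X ^ (n + 1)))
    simp only [Polynomial.eval_prod, Polynomial.eval_sub, Polynomial.eval_one, Polynomial.eval_pow,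
      Polynomial.eval_X] at this
    rw [this]
    congr 1
    refine (map_prod (Polynomial.coeToPowerSeries.ringHom (R := ℂ)) _ s).trans ?_
    simp

end TaylorSeries

/-! ### The q-expansion of the discriminant. -/

section Discriminant

open UpperHalfPlane ModularForm EisensteinSeries
open scoped MatrixGroups

theorem qExpansion_discriminant :
    qExpansion 1 ModularForm.discriminant =
      PowerSeries.X * PowerSeries.pentagonalSeries ℂ ^ 24 := by
  have hball : Metric.ball (0 : ℂ) 1 ∈ nhds (0 : ℂ) := Metric.ball_mem_nhds _ one_pos
  have han : AnalyticAt ℂ (fun q : ℂ => ∏' n : ℕ, (1 - q ^ (n + 1))) 0 :=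
    differentiableOn_tprod_one_sub_pow.analyticAt hball
  -- By definition the q-expansion is the Taylor series at 0 of the cusp function.
  change taylorSeriesZero (cuspFunction 1 ModularForm.discriminant) = _
  have heq : cuspFunction 1 ModularForm.discriminant =ᶠ[nhds 0]
      (fun q : ℂ => q) * (fun q : ℂ => ∏' n : ℕ, (1 - q ^ (n + 1))) ^ 24 := by
    filter_upwards [hball] with q hq
    rw [discriminant_cuspFunction_eqOn hq]
    simp only [Pi.mul_apply, Pi.pow_apply]
    rw [(multipliable_one_sub_pow (by simpa using hq)).tprod_pow 24]
  rw [taylorSeriesZero_congr heq,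
    taylorSeriesZero_mul (show AnalyticAt ℂ (fun q : ℂ => q) 0 from analyticAt_id) (han.pow 24),
    taylorSeriesZero_pow han, taylorSeriesZero_tprod_one_sub_pow]
  congr 1
  simpa using taylorSeriesZero_eval Polynomial.X

theorem sigmaSeries_cube_sub_sq :
    (1 + 240 * sigmaSeries ℂ 3) ^ 3 - (1 - 504 * sigmaSeries ℂ 5) ^ 2 =
      1728 * (PowerSeries.X * PowerSeries.pentagonalSeries ℂ ^ 24) := by
  let f : ModularForm 𝒮ℒ 12 := ModularForm.mcast (by decide) (E₄.pow 3) -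
    ModularForm.mcast (by decide) (E₆.pow 2)
  have h1 : qExpansion 1 f =
      (1 + 240 * sigmaSeries ℂ 3) ^ 3 - (1 - 504 * sigmaSeries ℂ 5) ^ 2 := by
    simp only [f, FunLike.coe_sub, coe_mcast,
      ModularForm.qExpansion_sub one_pos one_mem_strictPeriods_SL,
      ModularForm.qExpansion_pow one_pos one_mem_strictPeriods_SL, qExpansion_E₄, qExpansion_E₆]
  have h2 : (f : ℍ → ℂ) = (1728 : ℂ) • CuspForm.discriminant := by
    ext z
    have := discriminant_eq_E₄_cube_sub_E₆_sq z
    simp only [f, FunLike.coe_sub, coe_mcast, coe_pow, Pi.sub_apply, Pi.pow_apply, Pi.smul_apply,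
      CuspForm.coe_discriminant, this, smul_eq_mul]
    ring
  rw [← h1, h2, ModularForm.qExpansion_smul one_pos one_mem_strictPeriods_SL,
    CuspForm.coe_discriminant, qExpansion_discriminant, PowerSeries.smul_eq_C_mul]
  rfl

end Discriminant

/-! ### The derivation θ and logarithmic derivatives of Euler products. -/

section Theta

open PowerSeries

/-- The derivation `X d/dX` on power series. -/
noncomputable def theta (R : Type*) [CommRing R] : Derivation R R⟦X⟧ R⟦X⟧ :=
  (X : R⟦X⟧) • derivative R

variable {R : Type*} [CommRing R]

theorem theta_apply (f : R⟦X⟧) : theta R f = X * derivative R f := rfl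

theorem coeff_theta (f : R⟦X⟧) (n : ℕ) : coeff n (theta R f) = n * coeff n f := by
  cases n with
  | zero => simp [theta_apply]
  | succ n =>
    rw [theta_apply, coeff_succ_X_mul, coeff_derivative]
    push_cast
    ring

theorem theta_X_pow (n : ℕ) : theta R (X ^ n : R⟦X⟧) = n * (X : R⟦X⟧) ^ n := by
  ext m
  rw [coeff_theta]
  simp only [coeff_X_pow, mul_ite, mul_one, mul_zero]
  rw [show (n : R⟦X⟧) = C (n : R) by simp, coeff_C_mul, coeff_X_pow]
  split_ifs with h <;> simp [h]

/-- The series `d ∑ X^m`, over the positive multiples `m` of `d`. -/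
noncomputable def divisorTerm (R : Type*) [CommRing R] (d : ℕ) : R⟦X⟧ :=
  PowerSeries.mk fun m => if m ≠ 0 ∧ d ∣ m then (d : R) else 0

theorem one_sub_X_pow_mul_divisorTerm {d : ℕ} (hd : d ≠ 0) :
    (1 - X ^ d : R⟦X⟧) * divisorTerm R d = d * (X : R⟦X⟧) ^ d := by
  ext m
  rw [sub_mul, one_mul, map_sub, coeff_X_pow_mul', divisorTerm, coeff_mk,
    show (d : R⟦X⟧) = C (d : R) by simp, coeff_C_mul, coeff_X_pow]
  by_cases hdm : d ≤ m
  · rw [if_pos hdm, coeff_mk]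
    obtain ⟨k, rfl⟩ := Nat.exists_eq_add_of_le hdm
    rw [Nat.add_sub_cancel_left]
    by_cases hk : k = 0
    · simp [hk, hd]
    · simp [hk]
  · have h1 : ¬ (m ≠ 0 ∧ d ∣ m) := fun h => hdm (Nat.le_of_dvd (Nat.pos_of_ne_zero h.1) h.2)
    have h2 : m ≠ d := fun h => hdm h.ge
    simp [hdm, h1, h2]

theorem theta_prod_one_sub_X_pow (s : Finset ℕ) :
    theta R (∏ n ∈ s, (1 - X ^ (n + 1))) =
      -((∏ n ∈ s, (1 - X ^ (n + 1))) * ∑ n ∈ s, divisorTerm R (n + 1)) := by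
  induction s using Finset.cons_induction with
  | empty => simp
  | cons a s ha ih =>
    rw [Finset.prod_cons, Finset.sum_cons, Derivation.leibniz, ih, map_sub, theta_X_pow,
      Derivation.map_one_eq_zero]
    have h := one_sub_X_pow_mul_divisorTerm (R := R) a.succ_ne_zero
    simp only [smul_eq_mul, Nat.succ_eq_add_one] at h ⊢
    linear_combination (∏ n ∈ s, (1 - X ^ (n + 1) : R⟦X⟧)) * h

theorem hasSum_divisorTerm [TopologicalSpace R] :
    HasSum (fun n => divisorTerm R (n + 1)) (sigmaSeries R 1) := by
  rw [WithPiTopology.hasSum_iff_hasSum_coeff]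
  intro m
  have h : coeff m (sigmaSeries R 1) = ∑ n ∈ Finset.range m, coeff m (divisorTerm R (n + 1)) := by
    simp only [sigmaSeries, divisorTerm, coeff_mk]
    rcases eq_or_ne m 0 with rfl | hm
    · simp
    rw [ArithmeticFunction.sigma_one_apply, Nat.cast_sum, Nat.divisors, Finset.sum_filter,
      Finset.sum_Ico_eq_sum_range]
    simp [hm, add_comm 1]
  rw [h]
  apply hasSum_sum_of_ne_finset_zero
  intro n hn
  simp only [divisorTerm, coeff_mk]
  rw [if_neg]
  rintro ⟨h0, hd⟩
  exact hn (Finset.mem_range.2 (Nat.le_of_dvd (Nat.pos_of_ne_zero h0) hd))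

theorem continuous_theta [TopologicalSpace R] [IsTopologicalRing R] : Continuous (theta R) := by
  rw [continuous_iff_continuousAt]
  intro f
  rw [ContinuousAt, WithPiTopology.tendsto_iff_coeff_tendsto]
  intro d
  simp only [coeff_theta]
  exact ((WithPiTopology.continuous_coeff R d).tendsto f).const_mul _

/-- Logarithmic differentiation of the finite products, followed by passage to the limit, which is
legitimate because θ is continuous coefficientwise. -/
theorem theta_pentagonalSeries :
    theta R (pentagonalSeries R) = -(pentagonalSeries R * sigmaSeries R 1) := by
  let : TopologicalSpace R := ⊥
  have : DiscreteTopology R := ⟨rfl⟩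
  have h1 := WithPiTopology.hasProd_one_sub_X_pow R
  have h2 := ((continuous_theta (R := R)).tendsto _).comp h1
  refine tendsto_nhds_unique h2 ?_
  have h3 := (Filter.Tendsto.mul h1 (hasSum_divisorTerm (R := R))).neg
  refine h3.congr fun s => ?_
  exact (theta_prod_one_sub_X_pow s).symm

/-- The series `X ∏ (1 - X^n)^24`. -/
noncomputable def deltaSeries (R : Type*) [CommRing R] : R⟦X⟧ := X * pentagonalSeries R ^ 24

theorem theta_deltaSeries :
    theta R (deltaSeries R) = (1 - 24 * sigmaSeries R 1) * deltaSeries R := by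
  have hX : theta R X = X := by simpa using theta_X_pow (R := R) 1
  rw [deltaSeries, Derivation.leibniz, Derivation.leibniz_pow, hX, theta_pentagonalSeries]
  simp only [smul_eq_mul, nsmul_eq_mul]
  push_cast
  ring

theorem coeff_iterate_theta (f : R⟦X⟧) (k n : ℕ) :
    coeff n ((theta R)^[k] f) = n ^ k * coeff n f := by
  induction k with
  | zero => simp
  | succ k ih => rw [Function.iterate_succ_apply', coeff_theta, ih, pow_succ']; ring

end Theta

/-! ### Transfer of the identities from ℂ to arbitrary commutative rings. -/

section Map
open PowerSeries

theorem map_pentagonalSeries {R S : Type*} [CommRing R] [CommRing S] (φ : R →+* S) :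
    PowerSeries.map φ (pentagonalSeries R) = pentagonalSeries S := by
  ext n
  by_cases h : n ∈ Set.range pentagonal
  · obtain ⟨k, rfl⟩ := h
    simp
  · simp [coeff_pentagonalSeries_eq_zero _ h]

theorem map_deltaSeries {R S : Type*} [CommRing R] [CommRing S] (φ : R →+* S) :
    PowerSeries.map φ (deltaSeries R) = deltaSeries S := by
  simp [deltaSeries, map_pentagonalSeries]

theorem map_intCast_complex_injective :
    Function.Injective (PowerSeries.map (Int.castRingHom ℂ)) :=
  PowerSeries.map_injective _ Int.cast_injective

/-- Both sides have integer coefficients, so the complex identity descends to ℤ and then maps to any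
ring; the next two identities are transferred in the same way. -/
theorem sigmaSeries_fourteen_eq (R : Type*) [CommRing R] :
    1 - 24 * sigmaSeries R 13 =
      (1 + 240 * sigmaSeries R 3) ^ 2 * (1 - 504 * sigmaSeries R 5) := by
  have h : 1 - 24 * sigmaSeries ℤ 13 =
      (1 + 240 * sigmaSeries ℤ 3) ^ 2 * (1 - 504 * sigmaSeries ℤ 5) := by
    apply map_intCast_complex_injective
    simp only [map_sub, map_add, map_mul, map_pow, map_one, map_ofNat, map_sigmaSeries]
    exact sigmaSeries_fourteen
  have h' := congrArg (PowerSeries.map (Int.castRingHom R)) h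
  simp only [map_sub, map_add, map_mul, map_pow, map_one, map_ofNat, map_sigmaSeries] at h'
  exact h'

theorem sigmaSeries_twelve_eq (R : Type*) [CommRing R] :
    691 + 65520 * sigmaSeries R 11 =
      441 * (1 + 240 * sigmaSeries R 3) ^ 3 + 250 * (1 - 504 * sigmaSeries R 5) ^ 2 := by
  have h : 691 + 65520 * sigmaSeries ℤ 11 =
      441 * (1 + 240 * sigmaSeries ℤ 3) ^ 3 + 250 * (1 - 504 * sigmaSeries ℤ 5) ^ 2 := by
    apply map_intCast_complex_injective
    simp only [map_sub, map_add, map_mul, map_pow, map_one, map_ofNat, map_sigmaSeries]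
    exact sigmaSeries_twelve
  have h' := congrArg (PowerSeries.map (Int.castRingHom R)) h
  simp only [map_sub, map_add, map_mul, map_pow, map_one, map_ofNat, map_sigmaSeries] at h'
  exact h'

theorem sigmaSeries_cube_sub_sq_eq (R : Type*) [CommRing R] :
    (1 + 240 * sigmaSeries R 3) ^ 3 - (1 - 504 * sigmaSeries R 5) ^ 2 =
      1728 * deltaSeries R := by
  have h : (1 + 240 * sigmaSeries ℤ 3) ^ 3 - (1 - 504 * sigmaSeries ℤ 5) ^ 2 =
      1728 * deltaSeries ℤ := by
    apply map_intCast_complex_injective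
    simp only [map_sub, map_add, map_mul, map_pow, map_one, map_ofNat, map_sigmaSeries,
      map_deltaSeries]
    exact sigmaSeries_cube_sub_sq
  have h' := congrArg (PowerSeries.map (Int.castRingHom R)) h
  simp only [map_sub, map_add, map_mul, map_pow, map_one, map_ofNat, map_sigmaSeries,
      map_deltaSeries] at h'
  exact h'

end Map

instance fact_prime_thirteen : Fact (Nat.Prime 13) := ⟨by norm_num⟩

/-! ### Ramanujan's differential relations modulo 13. -/

section ModThirteen

open PowerSeries

local notation "𝔽" => ZMod 13

theorem thirteen_eq_zero : (13 : 𝔽⟦X⟧) = 0 := by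
  rw [show (13 : 𝔽⟦X⟧) = C (13 : 𝔽) from (map_ofNat C 13).symm,
    show (13 : 𝔽) = 0 by decide, map_zero]

/-- The reduction modulo 13 of `E₄`. -/
noncomputable def eisenFour : 𝔽⟦X⟧ := 1 + 240 * sigmaSeries 𝔽 3

/-- The reduction modulo 13 of `E₆`. -/
noncomputable def eisenSix : 𝔽⟦X⟧ := 1 - 504 * sigmaSeries 𝔽 5

theorem sigmaSeries_thirteen : sigmaSeries 𝔽 13 = sigmaSeries 𝔽 1 := by
  ext n
  simp only [sigmaSeries, coeff_mk, ArithmeticFunction.sigma_apply, Nat.cast_sum, Nat.cast_pow,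
    pow_one, ZMod.pow_card]

/-- This is E₁₂ ≡ 1: 13 divides 65520, and Q³ is eliminated through Q³ - R² = 1728Δ. -/
theorem eisenSix_sq : eisenSix ^ 2 = 1 + 6 * deltaSeries 𝔽 := by
  have h1 := sigmaSeries_twelve_eq 𝔽
  have h2 := sigmaSeries_cube_sub_sq_eq 𝔽
  rw [← eisenFour, ← eisenSix] at h1 h2
  linear_combination -7 * h1 - 3087 * h2 + (372 - 372 * eisenSix ^ 2 - 410334 * deltaSeries 𝔽 +
    35280 * sigmaSeries 𝔽 11) * thirteen_eq_zero

theorem eisenFour_cube : eisenFour ^ 3 = 1 + 5 * deltaSeries 𝔽 := by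
  have h2 := sigmaSeries_cube_sub_sq_eq 𝔽
  rw [← eisenFour, ← eisenSix] at h2
  linear_combination h2 + eisenSix_sq + 133 * deltaSeries 𝔽 * thirteen_eq_zero

theorem theta_deltaSeries_mod :
    theta 𝔽 (deltaSeries 𝔽) = eisenFour ^ 2 * eisenSix * deltaSeries 𝔽 := by
  rw [theta_deltaSeries, ← sigmaSeries_thirteen, sigmaSeries_fourteen_eq]
  rfl

theorem eisenFour_ne_zero : eisenFour ≠ 0 := by
  intro h
  simpa [eisenFour, sigmaSeries] using congrArg constantCoeff h

theorem eisenSix_ne_zero : eisenSix ≠ 0 := by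
  intro h
  simpa [eisenSix, sigmaSeries] using congrArg constantCoeff h

theorem theta_numeral_mul (n : ℕ) (f : 𝔽⟦X⟧) : theta 𝔽 (n * f) = n * theta 𝔽 f := by
  rw [← nsmul_eq_mul, map_nsmul, nsmul_eq_mul]

theorem theta_eisenFour : theta 𝔽 eisenFour = 6 * eisenSix * deltaSeries 𝔽 := by
  have h := congrArg (theta 𝔽) eisenFour_cube
  have h5 := theta_numeral_mul 5 (deltaSeries 𝔽)
  push_cast at h5
  rw [Derivation.leibniz_pow, map_add, Derivation.map_one_eq_zero, h5, theta_deltaSeries_mod] at h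
  simp only [smul_eq_mul, nsmul_eq_mul] at h
  push_cast at h
  apply mul_left_cancel₀ (pow_ne_zero 2 eisenFour_ne_zero)
  -- 9 is the inverse of 3 modulo 13.
  linear_combination 9 * h - (2 * eisenFour ^ 2 * theta 𝔽 eisenFour -
    3 * eisenFour ^ 2 * eisenSix * deltaSeries 𝔽) * thirteen_eq_zero

theorem theta_eisenSix : theta 𝔽 eisenSix = 3 * eisenFour ^ 2 * deltaSeries 𝔽 := by
  have h := congrArg (theta 𝔽) eisenSix_sq
  have h6 := theta_numeral_mul 6 (deltaSeries 𝔽)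
  push_cast at h6
  rw [Derivation.leibniz_pow, map_add, Derivation.map_one_eq_zero, h6, theta_deltaSeries_mod] at h
  simp only [smul_eq_mul, nsmul_eq_mul] at h
  push_cast at h
  apply mul_left_cancel₀ eisenSix_ne_zero
  linear_combination 7 * h - (eisenSix * theta 𝔽 eisenSix -
    3 * eisenFour ^ 2 * eisenSix * deltaSeries 𝔽) * thirteen_eq_zero

/-! ### Polynomials in Δ and the action of θ¹². -/

section Polynomial

open Polynomial (aeval derivative natDegree)

/-- Evaluation of polynomials at the reduction modulo 13 of the discriminant. -/
noncomputable def evalDelta : Polynomial 𝔽 →ₐ[𝔽] 𝔽⟦X⟧ := aeval (deltaSeries 𝔽)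

theorem evalDelta_X : evalDelta Polynomial.X = deltaSeries 𝔽 := Polynomial.aeval_X _

theorem theta_evalDelta (g : Polynomial 𝔽) : theta 𝔽 (evalDelta g) =
    evalDelta (derivative g) * (eisenFour ^ 2 * eisenSix * deltaSeries 𝔽) := by
  rw [evalDelta, Derivation.map_aeval, theta_deltaSeries_mod, smul_eq_mul]

/-- The first order differential operator `g ↦ a g + b g'`. -/
noncomputable def diffOp (a b g : Polynomial 𝔽) : Polynomial 𝔽 := a * g + b * derivative g

theorem natDegree_diffOp_le {a b g : Polynomial 𝔽} {k m : ℕ} (ha : natDegree a ≤ k)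
    (hb : natDegree b ≤ k + 1) (hg : natDegree g ≤ m) : natDegree (diffOp a b g) ≤ m + k := by
  refine Polynomial.natDegree_add_le_of_degree_le ?_ ?_
  · exact (Polynomial.natDegree_mul_le_of_le ha hg).trans (by omega)
  · rcases eq_or_ne (natDegree g) 0 with h | h
    · rw [Polynomial.derivative_of_natDegree_zero h]
      simp
    · exact (Polynomial.natDegree_mul_le_of_le hb (Polynomial.natDegree_derivative_le g)).trans
        (by omega)

/-- Modulo 13, θ raises the weight by 14, that is by 2 modulo 12. The successive prefactors Q²R, Q,
R, Q², QR, 1 represent the classes 2, 4, 6, 8, 10, 0. -/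
theorem exists_theta_six_evalDelta {g : Polynomial 𝔽} {m : ℕ} (hg : natDegree g ≤ m) :
    ∃ h : Polynomial 𝔽, natDegree h ≤ m + 7 ∧ (theta 𝔽)^[6] (evalDelta g) = evalDelta h := by
  let T : Polynomial 𝔽 := Polynomial.X
  -- The coefficients come from the Leibniz rule, with Q³ and R² rewritten as 1 + 5T and 1 + 6T. The
  -- degree gains are 0, 2, 1, 1, 1, 2, in total 7.
  let g₁ := diffOp 0 T g
  let g₂ := diffOp (12 * (1 + 6 * T) * T + 3 * (1 + 5 * T) * T) ((1 + 5 * T) * (1 + 6 * T) * T) g₁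
  let g₃ := diffOp (6 * T) ((1 + 5 * T) * T) g₂
  let g₄ := diffOp (3 * T) ((1 + 6 * T) * T) g₃
  let g₅ := diffOp (12 * T) ((1 + 5 * T) * T) g₄
  let g₆ := diffOp (6 * (1 + 6 * T) * T + 3 * (1 + 5 * T) * T) ((1 + 5 * T) * (1 + 6 * T) * T) g₅
  have hd₁ : natDegree g₁ ≤ m + 0 := natDegree_diffOp_le (by simp) (by simp [T]) hg
  have hd₂ : natDegree g₂ ≤ m + 0 + 2 :=
    natDegree_diffOp_le (by simp only [T]; compute_degree) (by simp only [T]; compute_degree) hd₁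
  have hd₃ : natDegree g₃ ≤ m + 0 + 2 + 1 :=
    natDegree_diffOp_le (by simp only [T]; compute_degree) (by simp only [T]; compute_degree) hd₂
  have hd₄ : natDegree g₄ ≤ m + 0 + 2 + 1 + 1 :=
    natDegree_diffOp_le (by simp only [T]; compute_degree) (by simp only [T]; compute_degree) hd₃
  have hd₅ : natDegree g₅ ≤ m + 0 + 2 + 1 + 1 + 1 :=
    natDegree_diffOp_le (by simp only [T]; compute_degree) (by simp only [T]; compute_degree) hd₄
  have hd₆ : natDegree g₆ ≤ m + 0 + 2 + 1 + 1 + 1 + 2 :=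
    natDegree_diffOp_le (by simp only [T]; compute_degree) (by simp only [T]; compute_degree) hd₅
  have hQ := eisenFour_cube
  have hR := eisenSix_sq
  have e₁ : theta 𝔽 (evalDelta g) = eisenFour ^ 2 * eisenSix * evalDelta g₁ := by
    rw [theta_evalDelta]
    simp only [g₁, diffOp, T, map_add, map_mul, map_zero, evalDelta_X]
    ring
  have e₂ : theta 𝔽 (eisenFour ^ 2 * eisenSix * evalDelta g₁) = eisenFour * evalDelta g₂ := by
    simp only [g₂, diffOp, T, map_add, map_mul, map_one, map_ofNat, evalDelta_X,
      Derivation.leibniz, Derivation.leibniz_pow, theta_eisenFour, theta_eisenSix,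
      theta_evalDelta, smul_eq_mul, nsmul_eq_mul, ← hQ, ← hR]
    push_cast
    ring
  have e₃ : theta 𝔽 (eisenFour * evalDelta g₂) = eisenSix * evalDelta g₃ := by
    simp only [g₃, diffOp, T, map_add, map_mul, map_one, map_ofNat, evalDelta_X,
      Derivation.leibniz, theta_eisenFour, theta_evalDelta, smul_eq_mul, ← hQ]
    ring
  have e₄ : theta 𝔽 (eisenSix * evalDelta g₃) = eisenFour ^ 2 * evalDelta g₄ := by
    simp only [g₄, diffOp, T, map_add, map_mul, map_one, map_ofNat, evalDelta_X,
      Derivation.leibniz, theta_eisenSix, theta_evalDelta, smul_eq_mul, ← hR]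
    ring
  have e₅ : theta 𝔽 (eisenFour ^ 2 * evalDelta g₄) = eisenFour * eisenSix * evalDelta g₅ := by
    simp only [g₅, diffOp, T, map_add, map_mul, map_one, map_ofNat, evalDelta_X,
      Derivation.leibniz, Derivation.leibniz_pow, theta_eisenFour,
      theta_evalDelta, smul_eq_mul, nsmul_eq_mul, ← hQ]
    push_cast
    ring
  have e₆ : theta 𝔽 (eisenFour * eisenSix * evalDelta g₅) = evalDelta g₆ := by
    simp only [g₆, diffOp, T, map_add, map_mul, map_one, map_ofNat, evalDelta_X,
      Derivation.leibniz, theta_eisenFour, theta_eisenSix,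
      theta_evalDelta, smul_eq_mul, ← hQ, ← hR]
    ring
  refine ⟨g₆, hd₆.trans (by omega), ?_⟩
  simp only [Function.iterate_succ_apply', Function.iterate_zero, id, e₁, e₂, e₃, e₄, e₅, e₆]

theorem constantCoeff_evalDelta (g : Polynomial 𝔽) :
    constantCoeff (evalDelta g) = g.coeff 0 := by
  rw [evalDelta, Polynomial.aeval_def, Polynomial.hom_eval₂]
  simp [deltaSeries, Polynomial.coeff_zero_eq_eval_zero]

theorem coeff_zero_pentagonalSeries (R : Type*) [CommRing R] :
    coeff 0 (pentagonalSeries R) = 1 := by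
  have h := coeff_pentagonalSeries_pentagonal R 0
  rwa [show pentagonal 0 = 0 by decide, Int.negOnePow_zero, Units.val_one, Int.cast_one] at h

theorem constantCoeff_pentagonalSeries (R : Type*) [CommRing R] :
    constantCoeff (pentagonalSeries R) = 1 := by
  rw [← coeff_zero_eq_constantCoeff_apply, coeff_zero_pentagonalSeries]

theorem coeff_one_deltaSeries : coeff 1 (deltaSeries 𝔽) = 1 := by
  rw [deltaSeries, show 1 = 0 + 1 from rfl, coeff_succ_X_mul, coeff_zero_eq_constantCoeff_apply,
    map_pow, constantCoeff_pentagonalSeries, one_pow]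

theorem deltaSeries_ne_zero : deltaSeries 𝔽 ≠ 0 := by
  intro h
  simpa [h] using coeff_one_deltaSeries

/-- Split off the largest power of X: the cofactor has nonzero constant term, which evaluation
preserves since Δ has none, and powers of Δ are nonzero. -/
theorem evalDelta_injective : Function.Injective evalDelta := by
  rw [injective_iff_map_eq_zero]
  intro p hp
  by_contra hne
  obtain ⟨q, hq, hdvd⟩ := p.exists_eq_pow_rootMultiplicity_mul_and_not_dvd hne 0
  rw [hq, map_mul, map_pow, map_sub, Polynomial.C_0, map_zero, sub_zero, evalDelta_X] at hp
  have hq0 := (mul_eq_zero.1 hp).resolve_left (pow_ne_zero _ deltaSeries_ne_zero)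
  have := constantCoeff_evalDelta q
  rw [hq0, map_zero] at this
  rw [Polynomial.C_0, sub_zero, Polynomial.X_dvd_iff] at hdvd
  exact hdvd this.symm

theorem pow_thirteen_eq_expand (f : 𝔽⟦X⟧) : f ^ 13 = expand 13 (by norm_num) f := by
  have h := MvPowerSeries.map_frobenius_expand 13 (by norm_num) (f := f)
  rw [ZMod.frobenius_zmod] at h
  rw [← h]
  exact congrFun (congrArg DFunLike.coe (MvPowerSeries.map_id)) _

theorem exists_coeff_deltaSeries_pow {j : ℕ} (hj : j ≠ 0) (hj' : j < 12) :
    ∃ c : 𝔽, ∀ m, coeff (13 * m) (deltaSeries 𝔽 ^ j) = c * coeff m (deltaSeries 𝔽) := by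
  obtain ⟨h₁, hd₁, he₁⟩ := exists_theta_six_evalDelta (g := Polynomial.X ^ j) (m := j)
    (Polynomial.natDegree_X_pow_le j)
  obtain ⟨h₂, hd₂, he₂⟩ := exists_theta_six_evalDelta hd₁
  have htheta : evalDelta h₂ = (theta 𝔽)^[12] (deltaSeries 𝔽 ^ j) := by
    rw [← he₂, ← he₁, map_pow, evalDelta_X]
    rfl
  set p : Polynomial 𝔽 := Polynomial.X ^ j - h₂ with hp
  -- The degree is at most j + 14 ≤ 25, so 13 is the only positive multiple of 13 available as an
  -- exponent.
  have hpd : natDegree p < 26 :=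
    (Polynomial.natDegree_sub_le_of_le (Polynomial.natDegree_X_pow_le j) hd₂).trans_lt (by omega)
  have hcoeff (n : ℕ) : coeff n (evalDelta p) =
      (1 - (n : 𝔽) ^ 12) * coeff n (deltaSeries 𝔽 ^ j) := by
    rw [hp, map_sub, htheta, map_sub, coeff_iterate_theta, map_pow, evalDelta_X]
    ring
  have hth : theta 𝔽 (evalDelta p) = 0 := by
    ext n
    rw [coeff_theta, hcoeff]
    rcases eq_or_ne (n : 𝔽) 0 with h | h
    · simp [h]
    · have : (n : 𝔽) ^ 12 = 1 := ZMod.pow_card_sub_one_eq_one h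
      simp [this]
  rw [theta_evalDelta] at hth
  have hder : derivative p = 0 := by
    apply evalDelta_injective
    rw [map_zero]
    exact (mul_eq_zero.1 hth).resolve_right (mul_ne_zero
      (mul_ne_zero (pow_ne_zero 2 eisenFour_ne_zero) eisenSix_ne_zero) deltaSeries_ne_zero)
  have hp0 : p.coeff 0 = 0 := by
    rw [← constantCoeff_evalDelta, ← coeff_zero_eq_constantCoeff_apply, hcoeff,
      coeff_zero_eq_constantCoeff_apply]
    simp [deltaSeries, hj]
  have hpc : p = Polynomial.C (p.coeff 13) * Polynomial.X ^ 13 := by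
    ext n
    rw [Polynomial.coeff_C_mul_X_pow]
    split_ifs with h
    · rw [h]
    · by_cases hn : 26 ≤ n
      · exact Polynomial.coeff_eq_zero_of_natDegree_lt (hpd.trans_le hn)
      · rcases n with - | n
        · exact hp0
        · have h' := congrArg (fun r => Polynomial.coeff r n) hder
          simp only [Polynomial.coeff_derivative, Polynomial.coeff_zero] at h'
          refine (mul_eq_zero.1 h').resolve_right ?_
          rw [← Nat.cast_succ, ZMod.natCast_eq_zero_iff]
          omega
  refine ⟨p.coeff 13, fun m => ?_⟩
  have h := hcoeff (13 * m)
  have h13 : ((13 * m : ℕ) : 𝔽) = 0 := by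
    rw [ZMod.natCast_eq_zero_iff]
    exact dvd_mul_right _ _
  rw [h13, zero_pow (by norm_num), sub_zero, one_mul] at h
  rw [← h, hpc, map_mul, map_pow, evalDelta_X, pow_thirteen_eq_expand, evalDelta,
    Polynomial.aeval_C, ← Algebra.smul_def, coeff_smul, smul_eq_mul, coeff_expand_mul]
  simp

end Polynomial

/-! ### The operator U and its action on eta-type products. -/

/-- The operator `∑ a(n) X^n ↦ ∑ a(d n) X^n`. -/
noncomputable def atkinU {R : Type*} [CommRing R] (d : ℕ) (f : R⟦X⟧) : R⟦X⟧ :=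
  PowerSeries.mk fun m => coeff (d * m) f

theorem atkinU_mul_expand {R : Type*} [CommRing R] {d : ℕ} (hd : d ≠ 0) (f g : R⟦X⟧) :
    atkinU d (f * expand d hd g) = atkinU d f * g := by
  ext m
  simp only [atkinU, coeff_mk, coeff_mul]
  symm
  refine Finset.sum_of_injOn (fun x => (d * x.1, d * x.2)) ?_ ?_ ?_ ?_
  · rintro ⟨a, b⟩ - ⟨a', b'⟩ - h
    simpa [hd] using h
  · rintro ⟨a, b⟩ h
    simp only [Finset.mem_coe, Finset.HasAntidiagonal.mem_antidiagonal] at h ⊢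
    rw [← mul_add, h]
  · rintro ⟨a, b⟩ h hn
    rw [Finset.HasAntidiagonal.mem_antidiagonal] at h
    dsimp only at h ⊢
    rw [coeff_expand_of_not_dvd, mul_zero]
    rintro ⟨b', rfl⟩
    obtain ⟨a', rfl⟩ : d ∣ a := (Nat.dvd_add_left (dvd_mul_right d b')).1 (h ▸ dvd_mul_right d m)
    refine hn ⟨(a', b'), ?_, rfl⟩
    rw [← mul_add] at h
    simpa using Nat.eq_of_mul_eq_mul_left (Nat.pos_of_ne_zero hd) h
  · rintro ⟨a, b⟩ -
    simp

/-- The factor φ^(13t) = φ^t(X¹³) passes through U, so U(f)·φ^t = U(Δ^j) = cΔ, and φ^t can be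
cancelled. -/
theorem exists_atkinU_eq {j t : ℕ} (hj : j ≠ 0) (hj' : j < 12) (ht : t ≤ 24) {f : 𝔽⟦X⟧}
    (hf : f * pentagonalSeries 𝔽 ^ (13 * t) = deltaSeries 𝔽 ^ j) :
    ∃ c : 𝔽, atkinU 13 f = C c * (X * pentagonalSeries 𝔽 ^ (24 - t)) := by
  obtain ⟨c, hc⟩ := exists_coeff_deltaSeries_pow hj hj'
  refine ⟨c, ?_⟩
  have hne : pentagonalSeries 𝔽 ≠ 0 := by
    intro h
    simpa [h] using constantCoeff_pentagonalSeries 𝔽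
  apply mul_right_cancel₀ (pow_ne_zero t hne)
  rw [← atkinU_mul_expand (by norm_num), ← pow_thirteen_eq_expand, ← pow_mul, mul_comm t, hf]
  ext m
  rw [atkinU, coeff_mk, hc, mul_assoc, coeff_C_mul, mul_assoc X, ← pow_add,
    Nat.sub_add_cancel ht, deltaSeries]

end ModThirteen

/-! ### The three congruences along progressions modulo 13, and the induction on k. -/

section PartitionCongruences

open PowerSeries

local notation "𝔽" => ZMod 13

theorem eulerPower_eq (r : ℕ) : eulerPower r = pentagonalSeries ℤ ^ r :=
  (((WithPiTopology.hasProd_one_sub_X_pow ℤ).pow r).tprod_eq)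

theorem cast_coeffA (n : ℕ) : (coeffA n : 𝔽) = coeff n (pentagonalSeries 𝔽 ^ 11) := by
  rw [coeffA, eulerPower_eq, ← map_pentagonalSeries (Int.castRingHom 𝔽), ← map_pow, coeff_map]
  rfl

theorem cast_coeffB (n : ℕ) : (coeffB n : 𝔽) = coeff n (pentagonalSeries 𝔽 ^ 23) := by
  rw [coeffB, eulerPower_eq, ← map_pentagonalSeries (Int.castRingHom 𝔽), ← map_pow, coeff_map]
  rfl

theorem partitionCount_mul_pentagonalSeries (R : Type*) [CommRing R] :
    (PowerSeries.mk fun n => (partitionCount n : R)) * pentagonalSeries R = 1 := by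
  let : TopologicalSpace R := ⊥
  have : DiscreteTopology R := ⟨rfl⟩
  have h1 := Nat.Partition.hasProd_powerSeriesMk_card_restricted R (fun _ => True)
  have h2 := HasProd.mul h1 (WithPiTopology.hasProd_one_sub_X_pow R)
  have h3 : (PowerSeries.mk fun n => (partitionCount n : R)) =
      PowerSeries.mk fun n => ((Nat.Partition.restricted n fun _ => True).card : R) := by
    ext n
    simp [partitionCount, Nat.Partition.restricted]
  rw [h3]
  refine h2.unique ?_
  convert hasProd_one using 2 with i
  rw [if_pos trivial]
  simp only [pow_mul]
  exact WithPiTopology.tsum_pow_mul_one_sub_of_constantCoeff_eq_zero (by simp)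

theorem theta_pentagonalSeries_pow {R : Type*} [CommRing R] (r : ℕ) :
    theta R (pentagonalSeries R ^ r) =
      C (-r : R) * (sigmaSeries R 1 * pentagonalSeries R ^ r) := by
  rcases r with - | r
  · simp
  · rw [Derivation.leibniz_pow, theta_pentagonalSeries]
    simp only [smul_eq_mul, nsmul_eq_mul, Nat.add_sub_cancel, map_neg, map_natCast]
    ring

/-- Comparing coefficients gives n·f_n = r ∑ σ(i) f_(n-i), where i = 0 contributes nothing; it
determines f_n while n is invertible modulo 13. A tabulated `L` can thus be certified by a finite
check. -/
theorem coeff_eq_of_theta_eq {f : 𝔽⟦X⟧} {r : 𝔽} (hf : theta 𝔽 f = C r * (sigmaSeries 𝔽 1 * f))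
    (L : ℕ → 𝔽) (h0 : coeff 0 f = L 0)
    (hL : ∀ n : ℕ, n < 13 → n * L n = r * ∑ x ∈ Finset.HasAntidiagonal.antidiagonal n,
      (ArithmeticFunction.sigma 1 x.1 : 𝔽) * L x.2) {n : ℕ} (hn : n < 13) :
    coeff n f = L n := by
  induction n using Nat.strong_induction_on with
  | _ n ih =>
    rcases eq_or_ne n 0 with rfl | hne
    · exact h0
    · have hn0 : (n : 𝔽) ≠ 0 := by
        rw [ne_eq, ZMod.natCast_eq_zero_iff]
        exact fun h => absurd (Nat.le_of_dvd (Nat.pos_of_ne_zero hne) h) (by omega)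
      apply mul_left_cancel₀ hn0
      rw [hL n hn, ← coeff_theta, hf, coeff_C_mul, coeff_mul]
      congr 1
      refine Finset.sum_congr rfl fun x hx => ?_
      rw [Finset.HasAntidiagonal.mem_antidiagonal] at hx
      rw [sigmaSeries, coeff_mk]
      rcases eq_or_ne x.1 0 with h | h
      · simp [h]
      · rw [ih x.2 (by omega) (by omega)]

theorem coeff_zero_pentagonalSeries_pow (r : ℕ) : coeff 0 (pentagonalSeries 𝔽 ^ r) = 1 := by
  rw [coeff_zero_eq_constantCoeff_apply, map_pow, constantCoeff_pentagonalSeries, one_pow]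

theorem coeffA_twelve : (coeffA 12 : 𝔽) = 8 := by
  rw [cast_coeffA, coeff_eq_of_theta_eq (theta_pentagonalSeries_pow 11)
    (fun n => [1, 2, 5, 10, 7, 10, 0, 6, 3, 1, 0, 11, 8].getD n 0)
    (coeff_zero_pentagonalSeries_pow 11) (by decide +kernel) (by norm_num)]
  rfl

theorem coeffB_five : (coeffB 5 : 𝔽) = 4 := by
  rw [cast_coeffB, coeff_eq_of_theta_eq (theta_pentagonalSeries_pow 23)
    (fun n => [1, 3, 9, 9, 12, 4, 0, 0, 4, 10, 1, 10, 3].getD n 0)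
    (coeff_zero_pentagonalSeries_pow 23) (by decide +kernel) (by norm_num)]
  rfl

theorem theta_partitionCount (R : Type*) [CommRing R] [IsDomain R] :
    theta R (PowerSeries.mk fun n => (partitionCount n : R)) =
      C 1 * (sigmaSeries R 1 * PowerSeries.mk fun n => (partitionCount n : R)) := by
  have h := partitionCount_mul_pentagonalSeries R
  have h' := congrArg (theta R) h
  rw [Derivation.leibniz, theta_pentagonalSeries, Derivation.map_one_eq_zero] at h'
  simp only [smul_eq_mul] at h'
  apply mul_right_cancel₀ (right_ne_zero_of_mul_eq_one h)
  rw [map_one]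
  linear_combination h'

theorem partitionCount_six : (partitionCount 6 : 𝔽) = 11 := by
  have h0 : (partitionCount 0 : 𝔽) = 1 := by
    have h := congrArg constantCoeff (partitionCount_mul_pentagonalSeries 𝔽)
    rwa [map_mul, constantCoeff_pentagonalSeries, mul_one, map_one,
      ← coeff_zero_eq_constantCoeff_apply, coeff_mk] at h
  have h := coeff_eq_of_theta_eq (theta_partitionCount 𝔽)
    (fun n => [1, 1, 2, 3, 5, 7, 11, 2, 9, 4, 3, 4, 12].getD n 0) (by rw [coeff_mk, h0]; rfl)
    (by decide +kernel) (show 6 < 13 by norm_num)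
  rwa [coeff_mk] at h

theorem partitionCount_thirteen_mul (m : ℕ) :
    (partitionCount (13 * m + 6) : 𝔽) = 11 * coeffA m := by
  set P : 𝔽⟦X⟧ := PowerSeries.mk fun n => (partitionCount n : 𝔽) with hP
  -- Since Pφ = 1, X⁷P·φ¹⁶⁹ = X⁷φ¹⁶⁸ = Δ⁷.
  obtain ⟨c, hc⟩ := exists_atkinU_eq (j := 7) (t := 13) (f := X ^ 7 * P) (by norm_num) (by norm_num)
    (by norm_num) (by
      have h := partitionCount_mul_pentagonalSeries 𝔽
      rw [deltaSeries]
      linear_combination (X ^ 7 * pentagonalSeries 𝔽 ^ 168) * h)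
  have key (n : ℕ) : (partitionCount (13 * n + 6) : 𝔽) = c * coeffA n := by
    have h := congrArg (coeff (n + 1)) hc
    rw [atkinU, coeff_mk, coeff_C_mul, coeff_succ_X_mul,
      show 13 * (n + 1) = 13 * n + 6 + 7 by ring, coeff_X_pow_mul, hP, coeff_mk] at h
    rw [h, cast_coeffA]
  have h0 := key 0
  rw [cast_coeffA, coeff_zero_eq_constantCoeff_apply, map_pow, constantCoeff_pentagonalSeries,
    one_pow, mul_one, mul_zero, zero_add, partitionCount_six] at h0
  rw [key, ← h0]

theorem coeffA_thirteen_mul (m : ℕ) : (coeffA (13 * m + 12) : 𝔽) = 8 * coeffB m := by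
  obtain ⟨c, hc⟩ := exists_atkinU_eq (j := 1) (t := 1) (f := X * pentagonalSeries 𝔽 ^ 11)
    (by norm_num) (by norm_num) (by norm_num) (by rw [deltaSeries]; ring)
  have key (n : ℕ) : (coeffA (13 * n + 12) : 𝔽) = c * coeffB n := by
    have h := congrArg (coeff (n + 1)) hc
    rw [atkinU, coeff_mk, coeff_C_mul, coeff_succ_X_mul,
      show 13 * (n + 1) = 13 * n + 12 + 1 by ring, coeff_succ_X_mul] at h
    rw [cast_coeffA, h, cast_coeffB]
  have h0 := key 0
  rw [cast_coeffB, coeff_zero_eq_constantCoeff_apply, map_pow, constantCoeff_pentagonalSeries,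
    one_pow, mul_one, mul_zero, zero_add, coeffA_twelve] at h0
  rw [key, ← h0]

theorem coeffB_thirteen_mul (m : ℕ) : (coeffB (13 * m + 5) : 𝔽) = 4 * coeffA m := by
  -- Here X⁸φ²³·φ¹⁶⁹ = X⁸φ¹⁹² = Δ⁸.
  obtain ⟨c, hc⟩ := exists_atkinU_eq (j := 8) (t := 13) (f := X ^ 8 * pentagonalSeries 𝔽 ^ 23)
    (by norm_num) (by norm_num) (by norm_num) (by rw [deltaSeries]; ring)
  have key (n : ℕ) : (coeffB (13 * n + 5) : 𝔽) = c * coeffA n := by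
    have h := congrArg (coeff (n + 1)) hc
    rw [atkinU, coeff_mk, coeff_C_mul, coeff_succ_X_mul,
      show 13 * (n + 1) = 13 * n + 5 + 8 by ring, coeff_X_pow_mul] at h
    rw [cast_coeffB, h, cast_coeffA]
  have h0 := key 0
  rw [cast_coeffA, coeff_zero_eq_constantCoeff_apply, map_pow, constantCoeff_pentagonalSeries,
    one_pow, mul_one, mul_zero, zero_add, coeffB_five] at h0
  rw [key, ← h0]

theorem partitionCount_of_index_eq (k : ℕ) :
    (∀ n N : ℕ, 24 * N = 13 ^ (2 * k + 1) * (24 * n + 11) + 1 →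
      (partitionCount N : 𝔽) = 11 * 6 ^ k * coeffA n) ∧
    (∀ n N : ℕ, 24 * N = 13 ^ (2 * k + 2) * (24 * n + 23) + 1 →
      (partitionCount N : 𝔽) = 10 * 6 ^ k * coeffB n) := by
  have step (k : ℕ) (h : ∀ n N : ℕ, 24 * N = 13 ^ (2 * k + 1) * (24 * n + 11) + 1 →
      (partitionCount N : 𝔽) = 11 * 6 ^ k * coeffA n) (n N : ℕ)
      (hN : 24 * N = 13 ^ (2 * k + 2) * (24 * n + 23) + 1) :
      (partitionCount N : 𝔽) = 10 * 6 ^ k * coeffB n := by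
    -- 24(13n+12) + 11 = 13(24n+23); likewise 24(13n+5) + 23 = 13(24n+11) in the induction step
    -- below.
    rw [h (13 * n + 12) N (by rw [hN]; ring), coeffA_thirteen_mul]
    have : (11 * 8 : 𝔽) = 10 := by decide
    linear_combination (6 ^ k * (coeffB n : 𝔽)) * this
  induction k with
  | zero =>
    refine ⟨fun n N hN => ?_, step 0 fun n N hN => ?_⟩ <;>
    · obtain rfl : N = 13 * n + 6 := by omega
      rw [partitionCount_thirteen_mul, pow_zero, mul_one]
  | succ k ih =>
    have h (n N : ℕ) (hN : 24 * N = 13 ^ (2 * (k + 1) + 1) * (24 * n + 11) + 1) :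
        (partitionCount N : 𝔽) = 11 * 6 ^ (k + 1) * coeffA n := by
      rw [ih.2 (13 * n + 5) N (by rw [hN]; ring), coeffB_thirteen_mul]
      have : (10 * 4 : 𝔽) = 11 * 6 := by decide
      linear_combination (6 ^ k * (coeffA n : 𝔽)) * this
    exact ⟨h, step (k + 1) h⟩

end PartitionCongruences

theorem corollary9 (k n : ℕ) :
    (24 ∣ 13 ^ (2 * k + 1) * (24 * n + 11) + 1 ∧
      (partitionCount ((13 ^ (2 * k + 1) * (24 * n + 11) + 1) / 24) : ℤ) ≡
        11 * 6 ^ k * coeffA n [ZMOD 13]) ∧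
    (24 ∣ 13 ^ (2 * k + 2) * (24 * n + 23) + 1 ∧
      (partitionCount ((13 ^ (2 * k + 2) * (24 * n + 23) + 1) / 24) : ℤ) ≡
        10 * 6 ^ k * coeffB n [ZMOD 13]) := by
  obtain ⟨c, hc⟩ : ∃ c, 13 ^ (2 * k) = 24 * c + 1 := by
    have hsq : 13 ^ (2 * k) % 24 = 1 := by
      rw [pow_mul, Nat.pow_mod]
      norm_num
    exact ⟨13 ^ (2 * k) / 24, by omega⟩
  have h1 : 24 ∣ 13 ^ (2 * k + 1) * (24 * n + 11) + 1 :=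
    ⟨13 * c * (24 * n + 11) + 13 * n + 6, by rw [pow_succ, hc]; ring⟩
  have h2 : 24 ∣ 13 ^ (2 * k + 2) * (24 * n + 23) + 1 :=
    ⟨169 * c * (24 * n + 23) + 169 * n + 162, by rw [pow_add, hc]; ring⟩
  obtain ⟨hA, hB⟩ := partitionCount_of_index_eq k
  refine ⟨⟨h1, ?_⟩, ⟨h2, ?_⟩⟩
  · rw [show (13 : ℤ) = ((13 : ℕ) : ℤ) from rfl, ← ZMod.intCast_eq_intCast_iff]
    push_cast
    exact hA n _ (Nat.mul_div_cancel' h1)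
  · rw [show (13 : ℤ) = ((13 : ℕ) : ℤ) from rfl, ← ZMod.intCast_eq_intCast_iff]
    push_cast
    exact hB n _ (Nat.mul_div_cancel' h2)
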